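/- Let $k$ be a field of characteristic zero. For $n\ge 1$ let $\mathscr{L}_n$ be the left-symmetric Witt algebra: the space of all $k$-derivations of $k[x_1,\ldots,x_n]$ with the bilinear product determined by $a\partial_i\cdot b\partial_j=(a\,\partial_i(b))\,\partial_j$, where $a,b\in k[x_1,\ldots,x_n]$ and $\partial_i=\partial/\partial x_i$. Let $T(\mathscr{L}_n)$ (triangular derivations) be the subalgebra of $\mathscr{L}_n$ spanned by all $x_i^{s_i}x_{i+1}^{s_{i+1}}\cdots x_n^{s_n}\partial_i$, and let $ST(\mathscr{L}_n)$ (strongly triangular derivations) be the subalgebra spanned by all $x_{i+1}^{s_{i+1}}\cdots x_n^{s_n}\partial_i$, where $1\le i\le n$ and the exponents are nonnegative integers. A variety of (not necessarily associative, not necessarily unital) $k$-algebras is the class of all $k$-algebras satisfying a given set of polynomial identities; the variety generated by a family of algebras is the smallest variety containing all of them. A $k$-algebra is left-symmetric if it satisfies $(xy)z-x(yz)=(yx)z-y(xz)$. Then the variety generated by all the algebras $ST(\mathscr{L}_n)$, $n\ge 1$, is the variety of all left-symmetric $k$-algebras. Likewise, the variety generated by all the algebras $T(\mathscr{L}_n)$,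 $n\ge 1$, is the variety of all left-symmetric $k$-algebras. -/

import Mathlib

noncomputable section

/-! ### Identities and varieties of (nonassociative) algebras -/

/-- The nonassociative polynomial `f` in the variables `y_0, y_1, ...` is an identity of the
`k`-algebra `A`: it vanishes under every substitution of elements of `A` for the variables. -/
def IsPolynomialIdentity (k : Type*) [Field k] (f : FreeNonUnitalNonAssocAlgebra k ℕ)
    (A : Type*) [NonUnitalNonAssocRing A] [Module k A] [IsScalarTower k A A]
    [SMulCommClass k A A] : Prop :=
  ∀ a : ℕ → A, FreeNonUnitalNonAssocAlgebra.lift k a f = 0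

/-- The `k`-algebra `A` belongs to the variety defined by the set `S` of identities. -/
def MemVariety (k : Type*) [Field k] (S : Set (FreeNonUnitalNonAssocAlgebra k ℕ))
    (A : Type*) [NonUnitalNonAssocRing A] [Module k A] [IsScalarTower k A A]
    [SMulCommClass k A A] : Prop :=
  ∀ f ∈ S, IsPolynomialIdentity k f A

/-- The `k`-algebra `A` belongs to the variety generated by the family `K` of `k`-algebras, that is,
to the smallest variety that contains every `K i`: it lies in every variety (the class of algebras
defined by some set of identities) which contains every `K i`. -/
def MemGeneratedVariety (k : Type*) [Field k] {ι : Type*} (K : ι → Type*)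
    [∀ i, NonUnitalNonAssocRing (K i)] [∀ i, Module k (K i)]
    [∀ i, IsScalarTower k (K i) (K i)] [∀ i, SMulCommClass k (K i) (K i)]
    (A : Type*) [NonUnitalNonAssocRing A] [Module k A] [IsScalarTower k A A]
    [SMulCommClass k A A] : Prop :=
  ∀ S : Set (FreeNonUnitalNonAssocAlgebra k ℕ), (∀ i, MemVariety k S (K i)) → MemVariety k S A

/-- The left-symmetric identity `(xy)z - x(yz) = (yx)z - y(xz)` holds in `A`. -/
def IsLeftSymmetric (A : Type*) [NonUnitalNonAssocRing A] : Prop :=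
  ∀ x y z : A, (x * y) * z - x * (y * z) = (y * x) * z - y * (x * z)

/-! ### The left-symmetric Witt algebra -/

/-- The underlying space of the left-symmetric Witt algebra of index `n`: all `k`-derivations of the
polynomial algebra `k[x_1, ..., x_n]`. -/
def LSWitt (k : Type*) [Field k] (n : ℕ) : Type _ :=
  Derivation k (MvPolynomial (Fin n) k) (MvPolynomial (Fin n) k)

namespace LSWitt

variable {k : Type*} [Field k] {n : ℕ}

instance : AddCommGroup (LSWitt k n) :=
  inferInstanceAs (AddCommGroup (Derivation k (MvPolynomial (Fin n) k) (MvPolynomial (Fin n) k)))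

instance : Module k (LSWitt k n) :=
  inferInstanceAs (Module k (Derivation k (MvPolynomial (Fin n) k) (MvPolynomial (Fin n) k)))

/-- An element of the left-symmetric Witt algebra, viewed as a derivation. -/
def toDer (D : LSWitt k n) : Derivation k (MvPolynomial (Fin n) k) (MvPolynomial (Fin n) k) := D

/-- The derivation `a ∂_i`. -/
def term (a : MvPolynomial (Fin n) k) (i : Fin n) : LSWitt k n :=
  (a • MvPolynomial.pderiv i :
    Derivation k (MvPolynomial (Fin n) k) (MvPolynomial (Fin n) k))

/-- The left-symmetric product: `D * E` is the derivation with `(D * E)(x_j) = D (E x_j)` for all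
`j`. By `term_mul_term` it is the bilinear product with `a∂_i * b∂_j = (a ∂_i(b)) ∂_j`. -/
instance : Mul (LSWitt k n) :=
  ⟨fun D E => MvPolynomial.mkDerivation k fun j => D.toDer (E.toDer (MvPolynomial.X j))⟩

theorem ext_X {D E : LSWitt k n}
    (h : ∀ j, D.toDer (MvPolynomial.X j) = E.toDer (MvPolynomial.X j)) : D = E :=
  MvPolynomial.derivation_ext h

@[simp] theorem toDer_zero : (0 : LSWitt k n).toDer = 0 := rfl

@[simp] theorem toDer_add (D E : LSWitt k n) : (D + E).toDer = D.toDer + E.toDer := rfl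

@[simp] theorem toDer_smul (c : k) (D : LSWitt k n) : (c • D).toDer = c • D.toDer := rfl

@[simp] theorem toDer_term (a : MvPolynomial (Fin n) k) (i : Fin n) :
    (term a i).toDer = a • MvPolynomial.pderiv i := rfl

@[simp] theorem toDer_mul_X (D E : LSWitt k n) (j : Fin n) :
    (D * E).toDer (MvPolynomial.X j) = D.toDer (E.toDer (MvPolynomial.X j)) :=
  MvPolynomial.mkDerivation_X k _ j

instance : NonUnitalNonAssocRing (LSWitt k n) :=
  { (inferInstance : AddCommGroup (LSWitt k n)), (inferInstance : Mul (LSWitt k n)) with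
    left_distrib := fun D E F => ext_X fun j => by simp
    right_distrib := fun D E F => ext_X fun j => by simp
    zero_mul := fun D => ext_X fun j => by simp
    mul_zero := fun D => ext_X fun j => by simp }

instance : IsScalarTower k (LSWitt k n) (LSWitt k n) :=
  ⟨fun c D E => ext_X fun j => by simp⟩

instance : SMulCommClass k (LSWitt k n) (LSWitt k n) :=
  ⟨fun c D E => ext_X fun j => by simp⟩

theorem term_mul_term (a b : MvPolynomial (Fin n) k) (i j : Fin n) :
    term a i * term b j = term (a * MvPolynomial.pderiv i b) j := by
  refine ext_X fun l => ?_
  by_cases h : l = j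
  · subst h; simp
  · simp [MvPolynomial.pderiv_X_of_ne h]

/-- The product of two monomial derivations is a scalar multiple of a monomial derivation. -/
theorem monomial_mul_monomial (s t : Fin n →₀ ℕ) (i j : Fin n) :
    term (MvPolynomial.monomial s (1 : k)) i * term (MvPolynomial.monomial t (1 : k)) j =
      (t i : k) • term (MvPolynomial.monomial (s + (t - Finsupp.single i 1)) (1 : k)) j := by
  rw [term_mul_term]
  refine ext_X fun l => ?_
  simp [MvPolynomial.pderiv_monomial, MvPolynomial.monomial_mul, MvPolynomial.smul_monomial,
    ← smul_mul_assoc]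

/-- The subspace spanned by the `x^s ∂_i`, `(s, i) ∈ G`, is closed under multiplication as soon as
`G` is closed under the products of monomial derivations that do not vanish. -/
theorem span_mul_mem (G : Set ((Fin n →₀ ℕ) × Fin n))
    (hG : ∀ p ∈ G, ∀ q ∈ G, q.1 p.2 ≠ 0 → (p.1 + (q.1 - Finsupp.single p.2 1), q.2) ∈ G)
    {D E : LSWitt k n}
    (hD : D ∈ Submodule.span k
      {F : LSWitt k n | ∃ p ∈ G, F = term (MvPolynomial.monomial p.1 (1 : k)) p.2})
    (hE : E ∈ Submodule.span k
      {F : LSWitt k n | ∃ p ∈ G, F = term (MvPolynomial.monomial p.1 (1 : k)) p.2}) :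
    D * E ∈ Submodule.span k
      {F : LSWitt k n | ∃ p ∈ G, F = term (MvPolynomial.monomial p.1 (1 : k)) p.2} := by
  induction hD using Submodule.span_induction with
  | zero => simp
  | add x y _ _ hx hy => rw [add_mul]; exact add_mem hx hy
  | smul c x _ hx => rw [smul_mul_assoc]; exact Submodule.smul_mem _ c hx
  | mem x hx =>
    obtain ⟨p, hp, rfl⟩ := hx
    induction hE using Submodule.span_induction with
    | zero => simp
    | add x y _ _ hx hy => rw [mul_add]; exact add_mem hx hy
    | smul c x _ hx => rw [mul_smul_comm]; exact Submodule.smul_mem _ c hx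
    | mem x hx =>
      obtain ⟨q, hq, rfl⟩ := hx
      rw [monomial_mul_monomial]
      by_cases h : q.1 p.2 = 0
      · simp [h]
      · exact Submodule.smul_mem _ _ (Submodule.subset_span ⟨_, hG p hp q hq h, rfl⟩)

variable (k n)

/-- The algebra of triangular derivations: the subalgebra of the left-symmetric Witt algebra spanned
by all `x_i^{s_i} x_{i+1}^{s_{i+1}} ... x_n^{s_n} ∂_i`. -/
def triangular : NonUnitalSubalgebra k (LSWitt k n) :=
  { Submodule.span k {F : LSWitt k n | ∃ p ∈ {p : (Fin n →₀ ℕ) × Fin n | ∀ j < p.2, p.1 j = 0},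
      F = term (MvPolynomial.monomial p.1 (1 : k)) p.2} with
    mul_mem' := by
      refine span_mul_mem _ ?_
      rintro ⟨s, i⟩ hs ⟨t, j⟩ ht hti l hl
      have hji : j ≤ i := not_lt.mp fun h => hti (ht i h)
      have h1 : s l = 0 := hs l (lt_of_lt_of_le hl hji)
      have h2 : t l = 0 := ht l hl
      simp [h1, h2] }

/-- The algebra of strongly triangular derivations: the subalgebra of the left-symmetric Witt algebra
spanned by all `x_{i+1}^{s_{i+1}} ... x_n^{s_n} ∂_i`. -/
def strongTriangular : NonUnitalSubalgebra k (LSWitt k n) :=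
  { Submodule.span k {F : LSWitt k n | ∃ p ∈ {p : (Fin n →₀ ℕ) × Fin n | ∀ j ≤ p.2, p.1 j = 0},
      F = term (MvPolynomial.monomial p.1 (1 : k)) p.2} with
    mul_mem' := by
      refine span_mul_mem _ ?_
      rintro ⟨s, i⟩ hs ⟨t, j⟩ ht hti l hl
      have hji : j < i := not_le.mp fun h => hti (ht i h)
      have h1 : s l = 0 := hs l (hl.trans hji.le)
      have h2 : t l = 0 := ht l hl
      simp [h1, h2] }

end LSWitt

end

/-!
The algebras `LSWitt k n` are left-symmetric, so only one direction needs an idea: an identity `f` of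
all the algebras of strongly triangular derivations has to vanish on every left-symmetric algebra.

Every element of the free algebra is a linear combination of values of rooted trees with labelled
vertices, where a tree is evaluated by iterating the braces `{v_1, ..., v_m; x}`
(`LabelledTree.span_eval_of`). In a left-symmetric algebra braces are symmetric (`brace_comp_perm`),
so the value of a tree depends only on its isomorphism class
(`LabelledTree.eval_eq_of_isoCount_ne_zero`).

Strongly triangular derivations separate the isomorphism classes. Given a tree `T`, introduce a
variable for each subtree, with branches placed after the trees they belong to, and substitute for
the variable `y_x` of `f` the sum of the derivations `(∏ j, x_{t_j}) ∂_t` over the subtrees `t` whose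
root has label `x` and whose branches are the `t_j`. The braces of derivations are explicit
(`LSWitt.toDer_brace_X`), and the constant coefficient of `∂_T` in the value of a tree `S` is the
number of isomorphisms from `S` to `T` (`LSWitt.constantCoeff_eval_treeDer`). In characteristic zero
this number is nonzero in `k` for `S = T`. Hence, if `f` vanishes under these substitutions, its
coefficients sum to zero over each isomorphism class of trees, and `f` vanishes on all left-symmetric
algebras (`LabelledTree.sum_smul_eval_eq_zero`). No multilinearization of `f` is needed.
-/

noncomputable section

/-! ### Symmetric braces -/

/-- The brace `{v_0, ..., v_{m-1}; x}`, defined in any algebra by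
`{v_0, v_1, ..., v_m; x} = v_0 {v_1, ..., v_m; x} - ∑ i, {v_1, ..., v_0 v_i, ..., v_m; x}`.
It is symmetric in the `v_i` as soon as the algebra is left-symmetric (`brace_comp_perm`). -/
def brace {A : Type*} [NonUnitalNonAssocRing A] : (m : ℕ) → (Fin m → A) → A → A
  | 0, _, x => x
  | m + 1, v, x => v 0 * brace m (Fin.tail v) x -
      ∑ i, brace m (Function.update (Fin.tail v) i (v 0 * Fin.tail v i)) x

section brace

variable {A : Type*} [NonUnitalNonAssocRing A]

theorem brace_succ {m : ℕ} (v : Fin (m + 1) → A) (x : A) :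
    brace (m + 1) v x = v 0 * brace m (Fin.tail v) x -
      ∑ i, brace m (Function.update (Fin.tail v) i (v 0 * Fin.tail v i)) x := rfl

/-- The recursion for braces read backwards. For trees it is the rule for grafting a tree onto each
vertex of another one. -/
theorem mul_brace {m : ℕ} (a : A) (v : Fin m → A) (x : A) :
    a * brace m v x = brace (m + 1) (Fin.cons a v) x +
      ∑ i, brace m (Function.update v i (a * v i)) x := by
  simp [brace_succ]

theorem map_brace {B F : Type*} [NonUnitalNonAssocRing B] [FunLike F A B]
    [NonUnitalRingHomClass F A B] (φ : F) {m : ℕ} (v : Fin m → A) (x : A) :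
    φ (brace m v x) = brace m (fun i => φ (v i)) (φ x) := by
  induction m with
  | zero => rfl
  | succ m ih =>
    simp only [brace_succ, map_sub, map_mul, map_sum, ih]
    congr 1
    refine Finset.sum_congr rfl fun i _ => congrArg (brace m · (φ x)) ?_
    funext j
    rcases eq_or_ne j i with rfl | h
    · simp [Fin.tail]
    · simp [Fin.tail, h]

/-- Braces are linear in each entry on the left of the semicolon. -/
theorem brace_update_smul_add {k : Type*} [CommRing k] [Module k A] [IsScalarTower k A A]
    [SMulCommClass k A A] {m : ℕ} (v : Fin m → A) (i : Fin m) (c : k) (a b x : A) :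
    brace m (Function.update v i (c • a + b)) x =
      c • brace m (Function.update v i a) x + brace m (Function.update v i b) x := by
  induction m generalizing a b with
  | zero => exact i.elim0
  | succ m ih =>
    induction i using Fin.cases with
    | zero =>
      simp only [brace_succ, Function.update_self, Fin.tail_update_zero, add_mul, smul_mul_assoc,
        ih, Finset.sum_add_distrib, ← Finset.smul_sum]
      module
    | succ j =>
      have key : ∀ (y : A) (l : Fin m), l ≠ j →
          Function.update (Function.update (Fin.tail v) j y) l
            (v 0 * Function.update (Fin.tail v) j y l) =
          Function.update (Function.update (Fin.tail v) l (v 0 * Fin.tail v l)) j y := by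
        intro y l hl
        rw [Function.update_of_ne hl, Function.update_comm hl.symm]
      simp only [brace_succ, Fin.tail_update_succ,
        Function.update_of_ne (Fin.succ_ne_zero j).symm, ih, mul_add, mul_smul_comm]
      simp only [← Finset.add_sum_erase _ _ (Finset.mem_univ j), Function.update_self,
        Function.update_idem]
      have h1 : ∀ y : A, ∑ l ∈ Finset.univ.erase j,
          brace m (Function.update (Function.update (Fin.tail v) j y) l
            (v 0 * Function.update (Fin.tail v) j y l)) x =
          ∑ l ∈ Finset.univ.erase j, brace m
            (Function.update (Function.update (Fin.tail v) l (v 0 * Fin.tail v l)) j y) x :=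
        fun y => Finset.sum_congr rfl fun l hl => by rw [key y l (Finset.ne_of_mem_erase hl)]
      simp only [h1, ih, mul_add, mul_smul_comm, Finset.sum_add_distrib, ← Finset.smul_sum]
      module

theorem brace_update_add {m : ℕ} (v : Fin m → A) (i : Fin m) (a b x : A) :
    brace m (Function.update v i (a + b)) x =
      brace m (Function.update v i a) x + brace m (Function.update v i b) x := by
  simpa using brace_update_smul_add v i (1 : ℤ) a b x

theorem brace_update_sub {m : ℕ} (v : Fin m → A) (i : Fin m) (a b x : A) :
    brace m (Function.update v i (a - b)) x =
      brace m (Function.update v i a) x - brace m (Function.update v i b) x := by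
  rw [eq_sub_iff_add_eq, ← brace_update_add, sub_add_cancel]

theorem brace_update_zero {m : ℕ} (v : Fin m → A) (i : Fin m) (x : A) :
    brace m (Function.update v i 0) x = 0 := by
  simpa using brace_update_sub v i 0 0 x

/-- By multilinearity, a submodule that contains the braces of all tuples from a generating set `s`
contains those of all tuples from the span of `s`. -/
theorem brace_mem {k : Type*} [CommRing k] [Module k A] [IsScalarTower k A A]
    [SMulCommClass k A A] {s : Set A} {N : Submodule k A} {x : A} {m : ℕ}
    (hs : ∀ v : Fin m → A, (∀ i, v i ∈ s) → brace m v x ∈ N) {v : Fin m → A}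
    (hv : ∀ i, v i ∈ Submodule.span k s) : brace m v x ∈ N := by
  suffices h : ∀ (t : Finset (Fin m)) (v : Fin m → A), (∀ i, v i ∈ Submodule.span k s) →
      (∀ i ∉ t, v i ∈ s) → brace m v x ∈ N from
    h Finset.univ v hv fun i hi => (hi (Finset.mem_univ i)).elim
  intro t
  induction t using Finset.induction_on with
  | empty => exact fun v _ h => hs v fun i => h i (Finset.notMem_empty i)
  | insert j t hj ih =>
    intro v hv h
    suffices h' : ∀ a ∈ Submodule.span k s, brace m (Function.update v j a) x ∈ N by
      simpa using h' (v j) (hv j)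
    intro a ha
    induction ha using Submodule.span_induction with
    | mem a ha =>
      refine ih _ (fun i => ?_) fun i hi => ?_
      · rcases eq_or_ne i j with rfl | hij
        · simpa using Submodule.subset_span ha
        · simpa [hij] using hv i
      · rcases eq_or_ne i j with rfl | hij
        · simpa using ha
        · simpa [hij] using h i (by simp [hij, hi])
    | zero => rw [brace_update_zero]; exact N.zero_mem
    | add a b _ _ iha ihb => rw [brace_update_add]; exact N.add_mem iha ihb
    | smul c a _ iha =>
      have := brace_update_smul_add v j c a 0 x
      rw [add_zero, brace_update_zero, add_zero] at this
      rw [this]; exact N.smul_mem c iha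

/-- The recursion unfolded twice. All terms are visibly symmetric in `a` and `b` except
`a * (b * _)`, the brace with entry `a * b`, and the diagonal `i = j` of the double sum. -/
theorem brace_cons_cons {m : ℕ} (a b : A) (w : Fin m → A) (x : A) :
    brace (m + 2) (Fin.cons a (Fin.cons b w)) x =
      (a * (b * brace m w x) - ∑ i, (a * brace m (Function.update w i (b * w i)) x +
        b * brace m (Function.update w i (a * w i)) x)) -
      brace (m + 1) (Fin.cons (a * b) w) x +
      ∑ i, ∑ j, brace m (Function.update (Function.update w i (a * w i)) j
        (b * Function.update w i (a * w i) j)) x := by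
  have h2 : ∀ i : Fin m, brace (m + 1) (Fin.cons b (Function.update w i (a * w i))) x =
      b * brace m (Function.update w i (a * w i)) x - ∑ j, brace m
        (Function.update (Function.update w i (a * w i)) j
          (b * Function.update w i (a * w i) j)) x := fun i => by
    rw [brace_succ, Fin.cons_zero, Fin.tail_cons]
  rw [brace_succ, Fin.cons_zero, Fin.tail_cons, Fin.sum_univ_succ, Fin.cons_zero,
    Fin.update_cons_zero]
  simp only [Fin.cons_succ, ← Fin.cons_update, h2]
  rw [brace_succ (Fin.cons b w), Fin.cons_zero, Fin.tail_cons]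
  simp only [mul_sub, Finset.mul_sum, Finset.sum_add_distrib, Finset.sum_sub_distrib]
  abel

/-- The asymmetric terms of `brace_cons_cons` are balanced by left symmetry, applied to
`a, b, {w; x}` and to `a, b, w_i` for each `i`. -/
theorem brace_swap_zero_one (hA : IsLeftSymmetric A) {m : ℕ} (a b : A) (w : Fin m → A) (x : A) :
    brace (m + 2) (Fin.cons a (Fin.cons b w)) x =
      brace (m + 2) (Fin.cons b (Fin.cons a w)) x := by
  have hsplit : ∀ a b : A, ∑ i, ∑ j, brace m (Function.update (Function.update w i (a * w i)) j
        (b * Function.update w i (a * w i) j)) x =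
      ∑ i, (brace m (Function.update w i (b * (a * w i))) x + ∑ j ∈ Finset.univ.erase i,
        brace m (Function.update (Function.update w i (a * w i)) j (b * w j)) x) := by
    intro a b
    refine Finset.sum_congr rfl fun i _ => ?_
    rw [← Finset.add_sum_erase _ _ (Finset.mem_univ i), Function.update_self,
      Function.update_idem]
    congr 1
    refine Finset.sum_congr rfl fun j hj => ?_
    rw [Function.update_of_ne (Finset.ne_of_mem_erase hj)]
  have hoff : ∑ i, ∑ j ∈ Finset.univ.erase i,
        brace m (Function.update (Function.update w i (a * w i)) j (b * w j)) x =
      ∑ i, ∑ j ∈ Finset.univ.erase i,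
        brace m (Function.update (Function.update w i (b * w i)) j (a * w j)) x := by
    rw [Finset.sum_comm' (s' := fun j => Finset.univ.erase j) (t' := Finset.univ)
      (by simp [eq_comm])]
    refine Finset.sum_congr rfl fun i _ => Finset.sum_congr rfl fun j hj => ?_
    rw [Function.update_comm (Finset.ne_of_mem_erase hj)]
  have hdiag : ∀ i, brace m (Function.update w i (b * (a * w i))) x +
        brace m (Function.update w i (a * b * w i)) x =
      brace m (Function.update w i (a * (b * w i))) x +
        brace m (Function.update w i (b * a * w i)) x := by
    intro i
    rw [← brace_update_add, ← brace_update_add]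
    congr 2
    have := hA a b (w i)
    rw [sub_eq_sub_iff_add_eq_add] at this
    rw [add_comm, this, add_comm]
  have hdiag' := Finset.sum_congr (rfl : (Finset.univ : Finset (Fin m)) = _) fun i _ => hdiag i
  rw [brace_cons_cons, brace_cons_cons, hsplit, hsplit, Finset.sum_add_distrib,
    Finset.sum_add_distrib, hoff]
  simp only [brace_succ, Fin.cons_zero, Fin.tail_cons]
  have hx := hA a b (brace m w x)
  simp only [Finset.sum_add_distrib] at hdiag' ⊢
  rw [sub_eq_iff_eq_add] at hx
  rw [hx, ← sub_eq_zero]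
  rw [← sub_eq_zero] at hdiag'
  rw [← hdiag']
  abel

/-- In a left-symmetric algebra braces are symmetric. Only transpositions of adjacent entries need
checking: the first one is `brace_swap_zero_one`, and the recursion reduces the others to shorter
tuples. -/
theorem brace_comp_perm (hA : IsLeftSymmetric A) {m : ℕ} (v : Fin m → A) (σ : Equiv.Perm (Fin m))
    (x : A) : brace m (v ∘ σ) x = brace m v x := by
  induction m with
  | zero => rfl
  | succ m ih =>
    have hσ : σ ∈ Submonoid.closure (Set.range fun i : Fin m => Equiv.swap i.castSucc i.succ) := by
      rw [Equiv.Perm.mclosure_swap_castSucc_succ]; trivial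
    induction hσ using Submonoid.closure_induction generalizing v with
    | one => rfl
    | mul σ τ _ _ hσ hτ => rw [Equiv.Perm.coe_mul, ← Function.comp_assoc, hτ, hσ]
    | mem σ h =>
      obtain ⟨i, rfl⟩ := h
      cases m with
      | zero => exact i.elim0
      | succ m =>
      induction i using Fin.cases with
      | zero =>
        have hv : v = Fin.cons (v 0) (Fin.cons (v 1) (Fin.tail (Fin.tail v))) := by
          funext i
          refine Fin.cases rfl (fun i => Fin.cases rfl (fun i => rfl) i) i
        have hv' : v ∘ Equiv.swap (0 : Fin (m + 2)) 1 =
            Fin.cons (v 1) (Fin.cons (v 0) (Fin.tail (Fin.tail v))) := by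
          funext i
          refine Fin.cases (by simp) (fun i => Fin.cases (by simp) (fun i => ?_) i) i
          have h1 : i.succ.succ ≠ (1 : Fin (m + 2)) := fun h => by
            simpa using congrArg Fin.val h
          simp [Equiv.swap_apply_of_ne_of_ne (Fin.succ_ne_zero _) h1, Fin.tail]
        simp only [Fin.castSucc_zero, Fin.succ_zero_eq_one]
        rw [hv', brace_swap_zero_one hA, ← hv]
      | succ j =>
        set τ := Equiv.swap j.castSucc j.succ with hτ
        have h0 : (v ∘ Equiv.swap j.succ.castSucc j.succ.succ) 0 = v 0 := by
          rw [Function.comp_apply, Equiv.swap_apply_of_ne_of_ne _ (Fin.succ_ne_zero _).symm]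
          exact fun h => by simpa using congrArg Fin.val h
        have ht : Fin.tail (v ∘ Equiv.swap j.succ.castSucc j.succ.succ) = Fin.tail v ∘ τ := by
          funext l
          simp only [Fin.tail, Function.comp_apply, hτ, ← Fin.succ_castSucc]
          rw [← (Fin.succ_injective _).map_swap]
        rw [brace_succ (m := m + 1), brace_succ (m := m + 1), h0, ht, ih]
        congr 1
        refine Fintype.sum_equiv τ _ _ fun l => ?_
        rw [← ih (Function.update (Fin.tail v) (τ l) _) τ]
        congr 1
        funext l'
        simp [Function.update_apply]

end brace

/-! ### Trees span the free algebra -/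

/-- Rooted trees with vertices labelled by natural numbers (the indices of the variables) and with
the children of each vertex numbered. Trees that differ in the numberings only are not identified;
they are compared by `LabelledTree.isoCount`. -/
inductive LabelledTree : Type
  | node (x : ℕ) (m : ℕ) (t : Fin m → LabelledTree) : LabelledTree

namespace LabelledTree

/-- The value of a tree under the substitution `a`: the brace of the values of the branches at the
root, applied to the value of the label of the root. -/
def eval {A : Type*} [NonUnitalNonAssocRing A] (a : ℕ → A) : LabelledTree → A
  | node x m t => brace m (fun i => (t i).eval a) (a x)

/-- The label of the root. -/
def label : LabelledTree → ℕ
  | node x _ _ => x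

/-- The number of children of the root. -/
def arity : LabelledTree → ℕ
  | node _ m _ => m

/-- The branches at the root. -/
def child : (T : LabelledTree) → Fin T.arity → LabelledTree
  | node _ _ t => t

variable {A : Type*} [NonUnitalNonAssocRing A]

theorem map_eval {B F : Type*} [NonUnitalNonAssocRing B] [FunLike F A B]
    [NonUnitalRingHomClass F A B] (φ : F) (a : ℕ → A) (T : LabelledTree) :
    φ (T.eval a) = T.eval fun i => φ (a i) := by
  induction T with
  | node x m t ih => simp only [eval, map_brace, ih]

theorem eval_mul_mem_span {k : Type*} [CommRing k] [Module k A] [IsScalarTower k A A]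
    [SMulCommClass k A A] (a : ℕ → A) (S T : LabelledTree) :
    S.eval a * T.eval a ∈ Submodule.span k (Set.range fun T : LabelledTree => T.eval a) := by
  have hbrace : ∀ {m : ℕ} {v : Fin m → A} (x : ℕ),
      (∀ i, v i ∈ Submodule.span k (Set.range fun T : LabelledTree => T.eval a)) →
      brace m v (a x) ∈ Submodule.span k (Set.range fun T : LabelledTree => T.eval a) := by
    intro m v x hv
    refine brace_mem (fun v hv => ?_) hv
    choose t ht using hv
    obtain rfl : (fun i => (t i).eval a) = v := funext ht
    exact Submodule.subset_span ⟨node x m t, rfl⟩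
  induction T with
  | node x m t ih =>
    rw [eval, mul_brace]
    refine Submodule.add_mem _ (hbrace x fun i => ?_) (Submodule.sum_mem _ fun i _ =>
      hbrace x fun j => ?_)
    · refine Fin.cases ?_ (fun i => ?_) i
      · exact Submodule.subset_span ⟨S, rfl⟩
      · exact Submodule.subset_span ⟨t i, rfl⟩
    · rcases eq_or_ne j i with rfl | h
      · simpa using ih j
      · simpa [h] using Submodule.subset_span (Set.mem_range_self (t j))

/-- The values of trees at the generators span the free algebra: their span contains the generators
and is closed under multiplication. -/
theorem span_eval_of (k : Type*) [Field k] :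
    Submodule.span k (Set.range fun T : LabelledTree =>
      T.eval (FreeNonUnitalNonAssocAlgebra.of k : ℕ → FreeNonUnitalNonAssocAlgebra k ℕ)) = ⊤ := by
  set N := Submodule.span k (Set.range fun T : LabelledTree =>
      T.eval (FreeNonUnitalNonAssocAlgebra.of k : ℕ → FreeNonUnitalNonAssocAlgebra k ℕ)) with hN
  let M : NonUnitalSubalgebra k (FreeNonUnitalNonAssocAlgebra k ℕ) :=
    { N with
      mul_mem' := by
        intro f g hf hg
        change f ∈ N at hf
        change g ∈ N at hg
        change f * g ∈ N
        induction hf using Submodule.span_induction with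
        | zero => simp
        | add f f' _ _ hf hf' => rw [add_mul]; exact N.add_mem hf hf'
        | smul c f _ hf => rw [smul_mul_assoc]; exact N.smul_mem c hf
        | mem f hf =>
          obtain ⟨S, rfl⟩ := hf
          induction hg using Submodule.span_induction with
          | zero => simp
          | add f f' _ _ hf hf' => rw [mul_add]; exact N.add_mem hf hf'
          | smul c f _ hf => rw [mul_smul_comm]; exact N.smul_mem c hf
          | mem g hg =>
            obtain ⟨T, rfl⟩ := hg
            exact eval_mul_mem_span _ S T }
  have hof : ∀ x : ℕ, FreeNonUnitalNonAssocAlgebra.of k x ∈ M := fun x =>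
    Submodule.subset_span ⟨node x 0 Fin.elim0, rfl⟩
  let φ : FreeNonUnitalNonAssocAlgebra k ℕ →ₙₐ[k] M :=
    FreeNonUnitalNonAssocAlgebra.lift k fun x => ⟨FreeNonUnitalNonAssocAlgebra.of k x, hof x⟩
  have hφ : (NonUnitalSubalgebraClass.subtype M).comp φ = NonUnitalAlgHom.id k _ := by
    refine FreeNonUnitalNonAssocAlgebra.hom_ext k fun x => ?_
    change ((φ (FreeNonUnitalNonAssocAlgebra.of k x) : M) : FreeNonUnitalNonAssocAlgebra k ℕ) = _
    rw [FreeNonUnitalNonAssocAlgebra.lift_of_apply]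
    rfl
  rw [eq_top_iff]
  intro f _
  have : ((φ f : M) : FreeNonUnitalNonAssocAlgebra k ℕ) = f := DFunLike.congr_fun hφ f
  rw [← this]
  exact (φ f).2

end LabelledTree

/-! ### Counting isomorphisms of trees -/

/-- The sum of the products `∏ i, q i (f i)` over all bijections `f` from `Fin m` onto the finite
set `s` (a permanent), expanded along the first row. -/
def matchSum {R ι : Type*} [CommSemiring R] [DecidableEq ι] :
    (m : ℕ) → (Fin m → ι → R) → Finset ι → R
  | 0, _, s => if s = ∅ then 1 else 0
  | m + 1, q, s => ∑ j ∈ s, q 0 j * matchSum m (Fin.tail q) (s.erase j)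

section matchSum

variable {R ι : Type*} [CommSemiring R] [DecidableEq ι]

theorem map_matchSum {R' : Type*} [CommSemiring R'] (φ : R →+* R') {m : ℕ} (q : Fin m → ι → R)
    (s : Finset ι) : φ (matchSum m q s) = matchSum m (fun i j => φ (q i j)) s := by
  induction m generalizing s with
  | zero => simp only [matchSum]; split_ifs <;> simp
  | succ m ih => simp only [matchSum, map_sum, map_mul, ih]; rfl

theorem exists_of_matchSum_ne_zero {m : ℕ} {q : Fin m → ι → R} {s : Finset ι}
    (h : matchSum m q s ≠ 0) :
    ∃ f : Fin m → ι, f.Injective ∧ Finset.univ.image f = s ∧ ∀ i, q i (f i) ≠ 0 := by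
  induction m generalizing s with
  | zero =>
    refine ⟨Fin.elim0, fun i => i.elim0, ?_, fun i => i.elim0⟩
    by_contra h'
    exact h (if_neg fun hs => h' (by simp [hs]))
  | succ m ih =>
    obtain ⟨j, hj, hne⟩ := Finset.exists_ne_zero_of_sum_ne_zero h
    obtain ⟨f, hf, him, hq⟩ := ih (right_ne_zero_of_mul hne)
    refine ⟨Fin.cons j f, Fin.cons_injective_iff.2 ⟨?_, hf⟩, ?_,
      Fin.cases (left_ne_zero_of_mul hne) hq⟩
    · rintro ⟨i, hi⟩
      have : f i ∈ s.erase j := him ▸ Finset.mem_image_of_mem f (Finset.mem_univ i)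
      exact Finset.ne_of_mem_erase this hi
    · rw [← Finset.insert_erase hj, ← him]
      ext l
      simp [Fin.exists_fin_succ, eq_comm]

theorem matchSum_pos {m : ℕ} {q : Fin m → ι → ℕ} {f : Fin m → ι} (hf : f.Injective)
    (hq : ∀ i, 0 < q i (f i)) : 0 < matchSum m q (Finset.univ.image f) := by
  induction m with
  | zero => simp [matchSum]
  | succ m ih =>
    refine (Nat.mul_pos (hq 0) ?_).trans_le (Finset.single_le_sum
      (f := fun j => q 0 j * matchSum m (Fin.tail q) ((Finset.univ.image f).erase j))
      (fun _ _ => Nat.zero_le _) (Finset.mem_image_of_mem f (Finset.mem_univ 0)))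
    have : (Finset.univ.image f).erase (f 0) = Finset.univ.image (f ∘ Fin.succ) := by
      ext j
      simp only [Finset.mem_erase, Finset.mem_image, Finset.mem_univ, true_and,
        Function.comp_apply]
      constructor
      · rintro ⟨hj, i, rfl⟩
        exact ⟨i.pred fun h => hj (by rw [h]), by simp⟩
      · rintro ⟨i, rfl⟩
        exact ⟨fun h => Fin.succ_ne_zero i (hf h), i.succ, rfl⟩
    rw [this]
    exact ih (hf.comp (Fin.succ_injective m)) fun i => hq i.succ

end matchSum

namespace LabelledTree

/-- The number of isomorphisms of labelled rooted trees that disregard the numbering of the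
children. -/
def isoCount : LabelledTree → LabelledTree → ℕ
  | node x m s, T =>
    if x = T.label then matchSum m (fun i j => isoCount (s i) (T.child j)) Finset.univ else 0

theorem isoCount_node (x y m m' : ℕ) (s : Fin m → LabelledTree) (t : Fin m' → LabelledTree) :
    isoCount (node x m s) (node y m' t) =
      if x = y then matchSum m (fun i j => isoCount (s i) (t j)) Finset.univ else 0 := rfl

theorem isoCount_self_pos (T : LabelledTree) : 0 < isoCount T T := by
  induction T with
  | node x m t ih =>
    rw [isoCount_node, if_pos rfl]
    have := matchSum_pos (q := fun i j => isoCount (t i) (t j)) Function.injective_id ih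
    rwa [Finset.image_id] at this

/-- Isomorphic trees have equal values in a left-symmetric algebra, since braces are symmetric. -/
theorem eval_eq_of_isoCount_ne_zero {A : Type*} [NonUnitalNonAssocRing A] (hA : IsLeftSymmetric A)
    (a : ℕ → A) {S T : LabelledTree} (h : isoCount S T ≠ 0) : S.eval a = T.eval a := by
  induction S generalizing T with
  | node x m s ih =>
    obtain ⟨y, m', t⟩ := T
    rw [isoCount_node] at h
    obtain rfl : x = y := by
      by_contra hxy
      exact h (if_neg hxy)
    rw [if_pos rfl] at h
    obtain ⟨f, hf, him, hq⟩ := exists_of_matchSum_ne_zero h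
    have hsurj : Function.Surjective f := fun j => by
      have : j ∈ Finset.univ.image f := him ▸ Finset.mem_univ j
      simpa using this
    obtain rfl : m = m' := by
      simpa using Fintype.card_of_bijective (⟨hf, hsurj⟩ : Function.Bijective f)
    have key : (fun i => (s i).eval a) =
        (fun i => (t i).eval a) ∘ Equiv.ofBijective f ⟨hf, hsurj⟩ :=
      funext fun i => ih i (hq i)
    rw [eval, eval, key, brace_comp_perm hA]

end LabelledTree

/-! ### Braces in the left-symmetric Witt algebra -/

namespace LSWitt

open MvPolynomial

variable {k : Type*} [Field k] {n : ℕ}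

/-- The commutator of the left-symmetric product is the commutator of derivations. -/
theorem isLeftSymmetric : IsLeftSymmetric (LSWitt k n) := by
  intro D E F
  have hcomm : (D * E).toDer - (E * D).toDer = ⁅D.toDer, E.toDer⁆ :=
    derivation_ext fun j => by
      rw [Derivation.sub_apply, toDer_mul_X, toDer_mul_X, Derivation.commutator_apply]
  rw [sub_eq_sub_iff_add_eq_add]
  refine ext_X fun j => ?_
  have := DFunLike.congr_fun hcomm (F.toDer (X j))
  rw [Derivation.sub_apply, Derivation.commutator_apply, sub_eq_sub_iff_add_eq_add] at this
  simp only [toDer_add, Derivation.add_apply, toDer_mul_X]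
  rw [this, add_comm]

theorem toDer_sum_apply {ι : Type*} (s : Finset ι) (F : ι → LSWitt k n)
    (g : MvPolynomial (Fin n) k) : (∑ i ∈ s, F i).toDer g = ∑ i ∈ s, (F i).toDer g :=
  map_sum (⟨⟨fun G : LSWitt k n => G.toDer g, rfl⟩, fun _ _ => rfl⟩ :
    LSWitt k n →+ MvPolynomial (Fin n) k) F s

theorem toDer_apply (D : LSWitt k n) (g : MvPolynomial (Fin n) k) :
    D.toDer g = ∑ v, D.toDer (X v) * pderiv v g := by
  have h : D = ∑ v, term (D.toDer (X v)) v := ext_X fun j => by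
    rw [toDer_sum_apply, Finset.sum_eq_single j]
    · simp
    · intro v _ hv
      simp [pderiv_X_of_ne hv.symm]
    · simp
  conv_lhs => rw [h]
  rw [toDer_sum_apply]
  rfl

theorem pderiv_comm (v w : Fin n) (g : MvPolynomial (Fin n) k) :
    pderiv v (pderiv w g) = pderiv w (pderiv v g) := by
  have h : ⁅(pderiv v : Derivation k (MvPolynomial (Fin n) k) _), pderiv w⁆ = 0 :=
    derivation_ext fun j => by
      rw [Derivation.commutator_apply]
      classical
      simp only [pderiv_X, Pi.single_apply]
      split_ifs <;> simp
  have := DFunLike.congr_fun h g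
  rwa [Derivation.commutator_apply, Derivation.zero_apply, sub_eq_zero] at this

/-- The differential operator `∑ D_0(x_{v_0}) ⋯ D_{m-1}(x_{v_{m-1}}) ∂_{v_0} ⋯ ∂_{v_{m-1}}`, summed
over all `v_0, ..., v_{m-1}`: the part of order `m` of the composite of the `D_i`. -/
def symbolOp : (m : ℕ) → (Fin m → LSWitt k n) →
    MvPolynomial (Fin n) k →ₗ[k] MvPolynomial (Fin n) k
  | 0, _ => LinearMap.id
  | m + 1, D => ∑ v, LinearMap.mulLeft k ((D 0).toDer (X v)) ∘ₗ symbolOp m (Fin.tail D) ∘ₗ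
      (pderiv v).toLinearMap

theorem symbolOp_zero (D : Fin 0 → LSWitt k n) (g : MvPolynomial (Fin n) k) :
    symbolOp 0 D g = g := rfl

theorem symbolOp_succ {m : ℕ} (D : Fin (m + 1) → LSWitt k n) (g : MvPolynomial (Fin n) k) :
    symbolOp (m + 1) D g =
      ∑ v, (D 0).toDer (X v) * symbolOp m (Fin.tail D) (pderiv v g) := by
  simp [symbolOp, LinearMap.sum_apply]

/-- The Leibniz rule: `E` either differentiates the argument `g` or one of the coefficients
`D_i(x_v)`, which turns `D_i` into `E * D_i`. -/
theorem toDer_symbolOp {m : ℕ} (E : LSWitt k n) (D : Fin m → LSWitt k n)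
    (g : MvPolynomial (Fin n) k) :
    E.toDer (symbolOp m D g) = symbolOp (m + 1) (Fin.cons E D) g +
      ∑ i, symbolOp m (Function.update D i (E * D i)) g := by
  induction m generalizing g with
  | zero =>
    rw [symbolOp_succ, symbolOp_zero, toDer_apply]
    simp [symbolOp_zero]
  | succ m ih =>
    rw [symbolOp_succ, map_sum, Fin.sum_univ_succ]
    simp only [Derivation.leibniz, smul_eq_mul, ih, symbolOp_succ, Fin.cons_zero, Fin.tail_cons,
      Function.update_self, Fin.tail_update_zero, Fin.tail_update_succ, toDer_mul_X,
      Function.update_of_ne (Fin.succ_ne_zero _).symm, mul_add, Finset.sum_add_distrib,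
      Finset.mul_sum]
    have h1 : ∑ v, ∑ w, (D 0).toDer (X v) *
          (E.toDer (X w) * symbolOp m (Fin.tail D) (pderiv w (pderiv v g))) =
        ∑ v, ∑ w, E.toDer (X v) *
          ((D 0).toDer (X w) * symbolOp m (Fin.tail D) (pderiv w (pderiv v g))) := by
      rw [Finset.sum_comm]
      refine Finset.sum_congr rfl fun v _ => Finset.sum_congr rfl fun w _ => ?_
      rw [pderiv_comm, mul_left_comm]
    have h2 : ∑ v, ∑ i, (D 0).toDer (X v) *
          symbolOp m (Function.update (Fin.tail D) i (E * Fin.tail D i)) (pderiv v g) =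
        ∑ i : Fin m, ∑ v, (D 0).toDer (X v) *
          symbolOp m (Function.update (Fin.tail D) i (E * D i.succ)) (pderiv v g) :=
      Finset.sum_comm
    rw [h1, h2, add_assoc]
    congr 1
    rw [add_comm]
    congr 1
    exact Finset.sum_congr rfl fun v _ => mul_comm _ _

/-- Braces of derivations are given by `symbolOp`, because both satisfy the same recursion. -/
theorem toDer_brace_X {m : ℕ} (D : Fin m → LSWitt k n) (E : LSWitt k n) (j : Fin n) :
    (brace m D E).toDer (X j) = symbolOp m D (E.toDer (X j)) := by
  induction m with
  | zero => rfl
  | succ m ih =>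
    have h := mul_brace (D 0) (Fin.tail D) E
    rw [Fin.cons_self_tail] at h
    have h' := congrArg (fun F => LSWitt.toDer F (X j)) h
    simp only [toDer_add, Derivation.add_apply, toDer_mul_X, toDer_sum_apply, ih] at h'
    rw [toDer_symbolOp, Fin.cons_self_tail] at h'
    exact (add_right_cancel h').symm

theorem _root_.Derivation.map_finset_prod {R B M ι : Type*} [CommSemiring R] [CommSemiring B]
    [AddCommMonoid M] [Algebra R B] [Module R M] [Module B M] [DecidableEq ι]
    (D : Derivation R B M) (f : ι → B) (s : Finset ι) :
    D (∏ j ∈ s, f j) = ∑ j ∈ s, (∏ l ∈ s.erase j, f l) • D (f j) := by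
  induction s using Finset.induction_on with
  | empty => simp
  | insert a s ha ih =>
    rw [Finset.prod_insert ha, D.leibniz, ih, Finset.sum_insert ha, Finset.erase_insert ha,
      add_comm, Finset.smul_sum]
    congr 1
    refine Finset.sum_congr rfl fun j hj => ?_
    have hja : a ≠ j := fun h => ha (h ▸ hj)
    rw [Finset.erase_insert_of_ne hja, Finset.prod_insert fun h => ha (Finset.mem_of_mem_erase h),
      mul_smul]

/-- At the origin, applying `symbolOp` of order `m` to a product of variables picks out the
bijections between the `m` derivations and the factors. -/
theorem constantCoeff_symbolOp_prod {ι : Type*} [DecidableEq ι] {m : ℕ} (D : Fin m → LSWitt k n)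
    (c : ι → Fin n) (s : Finset ι) :
    constantCoeff (symbolOp m D (∏ j ∈ s, X (c j))) =
      matchSum m (fun i j => constantCoeff ((D i).toDer (X (c j)))) s := by
  induction m generalizing s with
  | zero =>
    rw [symbolOp_zero, map_prod, matchSum]
    split_ifs with h
    · simp [h]
    · obtain ⟨j, hj⟩ := Finset.nonempty_iff_ne_empty.2 h
      exact Finset.prod_eq_zero hj (by simp)
  | succ m ih =>
    have hpd : ∀ v, pderiv v (∏ j ∈ s, X (c j) : MvPolynomial (Fin n) k) =
        ∑ j ∈ s, (Pi.single v 1 : Fin n → k) (c j) • ∏ l ∈ s.erase j, X (c l) := by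
      intro v
      rw [Derivation.map_finset_prod]
      refine Finset.sum_congr rfl fun j _ => ?_
      rcases eq_or_ne (c j) v with h | h
      · subst h; simp
      · simp [pderiv_X_of_ne h, h]
    simp only [symbolOp_succ, hpd, map_sum, map_smul, map_mul, matchSum,
      Finset.mul_sum]
    rw [Finset.sum_comm]
    refine Finset.sum_congr rfl fun j _ => ?_
    rw [Finset.sum_eq_single (c j)]
    · rw [Pi.single_eq_same, one_smul, ih]; rfl
    · intro v _ hv
      simp [hv.symm]
    · simp

end LSWitt

/-! ### Triangular derivations attached to a tree -/

namespace LabelledTree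

/-- A list of trees in which every branch at the root of an entry occurs again at a later position. -/
def IsChildClosed (τ : List LabelledTree) : Prop :=
  ∀ pre T suf, τ = pre ++ T :: suf → ∀ j, T.child j ∈ suf

theorem IsChildClosed.append {τ τ' : List LabelledTree} (h : IsChildClosed τ)
    (h' : IsChildClosed τ') : IsChildClosed (τ ++ τ') := by
  intro pre T suf heq j
  rcases List.append_eq_append_iff.1 heq with ⟨l, rfl, hl⟩ | ⟨l, hl, hl'⟩
  · exact h' l T suf hl j
  · cases l with
    | nil => exact h' [] T suf (by simpa using hl'.symm) j
    | cons U l =>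
      obtain ⟨rfl, rfl⟩ : T = U ∧ suf = l ++ τ' := by simpa using hl'
      exact List.mem_append_left _ (h pre T l hl j)

theorem exists_isChildClosed_mem (T : LabelledTree) : ∃ τ, IsChildClosed τ ∧ T ∈ τ := by
  induction T with
  | node x m t ih =>
    have hall : ∀ s : Finset (Fin m), ∃ τ, IsChildClosed τ ∧ ∀ i ∈ s, t i ∈ τ := by
      intro s
      induction s using Finset.induction_on with
      | empty => exact ⟨[], fun pre T suf h => by simp at h, by simp⟩
      | insert i s _ ihs =>
        obtain ⟨τ, hτ, hmem⟩ := ihs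
        obtain ⟨τ', hτ', hmem'⟩ := ih i
        refine ⟨τ' ++ τ, hτ'.append hτ, fun j hj => ?_⟩
        rcases Finset.mem_insert.1 hj with rfl | hj
        · exact List.mem_append_left _ hmem'
        · exact List.mem_append_right _ (hmem j hj)
    obtain ⟨τ, hτ, hmem⟩ := hall Finset.univ
    refine ⟨node x m t :: τ, fun pre U suf heq j => ?_, List.mem_cons_self⟩
    cases pre with
    | nil =>
      obtain ⟨rfl, rfl⟩ : node x m t = U ∧ τ = suf := by simpa using heq
      exact hmem j (Finset.mem_univ j)
    | cons V pre =>
      obtain ⟨-, h⟩ : node x m t = V ∧ τ = pre ++ U :: suf := by simpa using heq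
      exact hτ pre U suf h j

theorem IsChildClosed.exists_child_index {τ : List LabelledTree} (h : IsChildClosed τ)
    (v : Fin τ.length) (j : Fin (τ.get v).arity) : ∃ w, v < w ∧ τ.get w = (τ.get v).child j := by
  have hmem := h (τ.take v) (τ.get v) (τ.drop (v + 1)) (by simp) j
  obtain ⟨i, hi, heq⟩ := List.getElem_of_mem hmem
  rw [List.length_drop] at hi
  refine ⟨⟨v + 1 + i, by omega⟩, Fin.lt_def.2 (by simp; omega), ?_⟩
  rw [← heq]
  simp

end LabelledTree

namespace LSWitt

open MvPolynomial

variable {k : Type*} [Field k] {n : ℕ}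

/-- The derivation substituted for the variable `y_x`, when the variable `x_v` of the polynomial
ring stands for the tree `τ v` and `x_{c v j}` for its `j`-th branch: it is the sum of
`(∏ j, x_{c v j}) ∂_v` over all `v` for which the root of `τ v` has label `x`. -/
def treeDer (k : Type*) [Field k] {n : ℕ} (τ : Fin n → LabelledTree)
    (c : ∀ v, Fin (τ v).arity → Fin n) (x : ℕ) : LSWitt k n :=
  ∑ v, if x = (τ v).label then term (∏ j, X (c v j)) v else 0

theorem treeDer_mem_strongTriangular {τ : Fin n → LabelledTree}
    {c : ∀ v, Fin (τ v).arity → Fin n} (hc : ∀ v j, v < c v j) (x : ℕ) :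
    treeDer k τ c x ∈ strongTriangular k n := by
  refine sum_mem fun v _ => ?_
  split_ifs
  · refine Submodule.subset_span ⟨(∑ j, Finsupp.single (c v j) 1, v), fun i hi => ?_, ?_⟩
    · rw [Finsupp.finsetSum_apply]
      exact Finset.sum_eq_zero fun j _ =>
        Finsupp.single_eq_of_ne (hi.trans_lt (hc v j)).ne
    · rw [monomial_sum_one]
      rfl
  · exact zero_mem _

theorem toDer_treeDer_X (τ : Fin n → LabelledTree) (c : ∀ v, Fin (τ v).arity → Fin n) (x : ℕ)
    (v : Fin n) : (treeDer k τ c x).toDer (X v) =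
      if x = (τ v).label then ∏ j, X (c v j) else 0 := by
  rw [treeDer, toDer_sum_apply, Finset.sum_eq_single v]
  · split_ifs <;> simp
  · intro w _ hw
    split_ifs <;> simp [pderiv_X_of_ne hw.symm]
  · simp

/-- The constant term of the `v`-th component of the value of `S` counts the isomorphisms of `S` with
`τ v`: the factors of `∏ j, x_{c v j}` have to be matched with the branches of `S`, and these in
turn contribute the numbers of isomorphisms of the branches. -/
theorem constantCoeff_eval_treeDer {τ : Fin n → LabelledTree}
    {c : ∀ v, Fin (τ v).arity → Fin n} (hc : ∀ v j, τ (c v j) = (τ v).child j)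
    (S : LabelledTree) (v : Fin n) :
    constantCoeff ((S.eval (treeDer k τ c)).toDer (X v)) = (S.isoCount (τ v) : k) := by
  induction S generalizing v with
  | node x m s ih =>
    rw [LabelledTree.eval, toDer_brace_X, toDer_treeDer_X, LabelledTree.isoCount]
    split_ifs with h
    · rw [constantCoeff_symbolOp_prod, ← Nat.coe_castRingHom, map_matchSum]
      simp only [ih, hc, Nat.coe_castRingHom]
    · simp

theorem exists_constantCoeff_eval_eq_isoCount (k : Type*) [Field k] (T : LabelledTree) :
    ∃ (n : ℕ+) (d : ℕ → LSWitt k n) (v : Fin n), (∀ x, d x ∈ strongTriangular k n) ∧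
      ∀ S : LabelledTree, constantCoeff ((S.eval d).toDer (X v)) = (S.isoCount T : k) := by
  obtain ⟨τ, hτ, hT⟩ := T.exists_isChildClosed_mem
  obtain ⟨v, rfl⟩ := List.get_of_mem hT
  choose c hc hc' using hτ.exists_child_index
  exact ⟨⟨τ.length, v.pos⟩, treeDer k τ.get c, v, treeDer_mem_strongTriangular hc,
    fun S => constantCoeff_eval_treeDer hc' S v⟩

end LSWitt

/-! ### Independence of nonisomorphic trees and the generated varieties -/

namespace LabelledTree

/-- Isomorphic trees have the same isomorphism counts with all trees. This holds because the counts
are read off from values in a left-symmetric algebra. -/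
theorem isoCount_congr_left {S T : LabelledTree} (h : isoCount S T ≠ 0) :
    isoCount S = isoCount T := by
  funext U
  obtain ⟨n, d, v, -, hd⟩ := LSWitt.exists_constantCoeff_eval_eq_isoCount ℚ U
  have := hd S
  rw [eval_eq_of_isoCount_ne_zero LSWitt.isLeftSymmetric d h, hd T] at this
  exact_mod_cast this.symm

theorem lift_sum_eval {k : Type*} [Field k] {A : Type*} [NonUnitalNonAssocRing A] [Module k A]
    [IsScalarTower k A A] [SMulCommClass k A A] (a : ℕ → A) (s : LabelledTree →₀ k) :
    FreeNonUnitalNonAssocAlgebra.lift k a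
        (s.sum fun T r => r • T.eval (FreeNonUnitalNonAssocAlgebra.of k)) =
      ∑ T ∈ s.support, s T • T.eval a := by
  simp only [Finsupp.sum, map_sum, map_smul, map_eval,
    FreeNonUnitalNonAssocAlgebra.lift_of_apply]

/-- If the isomorphism counts with every tree annihilate a linear combination of trees, then its
value in every left-symmetric algebra vanishes: on each isomorphism class the values agree, and the
coefficients sum to zero. -/
theorem sum_smul_eval_eq_zero {k : Type*} [Field k] [CharZero k] {A : Type*}
    [NonUnitalNonAssocRing A] [Module k A] (hA : IsLeftSymmetric A) (a : ℕ → A)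
    (s : LabelledTree →₀ k) (hs : ∀ T, ∑ S ∈ s.support, s S * (isoCount S T : k) = 0) :
    ∑ S ∈ s.support, s S • S.eval a = 0 := by
  classical
  rw [← Finset.sum_fiberwise_of_maps_to (t := s.support.image isoCount) (g := isoCount)
    fun S hS => Finset.mem_image_of_mem _ hS]
  -- The fibres of `isoCount` are the isomorphism classes of trees.
  refine Finset.sum_eq_zero fun φ hφ => ?_
  obtain ⟨T, -, rfl⟩ := Finset.mem_image.1 hφ
  have hT : (isoCount T T : k) ≠ 0 := Nat.cast_ne_zero.2 T.isoCount_self_pos.ne'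
  have hfib : ∀ S ∈ s.support.filter (isoCount · = isoCount T), s S • S.eval a = s S • T.eval a :=
    fun S hS => by
      rw [eval_eq_of_isoCount_ne_zero hA a (T := T)]
      rw [(Finset.mem_filter.1 hS).2]
      exact T.isoCount_self_pos.ne'
  have hcoef : (∑ S ∈ s.support.filter (isoCount · = isoCount T), s S) *
      (isoCount T T : k) = 0 := by
    rw [← hs T, Finset.sum_mul, Finset.sum_filter]
    refine Finset.sum_congr rfl fun S _ => ?_
    split_ifs with h
    · rw [h]
    · rw [not_imp_comm.1 isoCount_congr_left h, Nat.cast_zero, mul_zero]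
  rw [Finset.sum_congr rfl hfib, ← Finset.sum_smul,
    (mul_eq_zero.1 hcoef).resolve_right hT, zero_smul]

end LabelledTree

open MvPolynomial in
/-- Every family of subalgebras of the left-symmetric Witt algebras that contain the strongly
triangular derivations generates the variety of left-symmetric algebras. -/
theorem memGeneratedVariety_iff_isLeftSymmetric (k : Type*) [Field k] [CharZero k]
    (H : ∀ n : ℕ+, NonUnitalSubalgebra k (LSWitt k n))
    (hH : ∀ n : ℕ+, LSWitt.strongTriangular k n ≤ H n)
    (A : Type*) [NonUnitalNonAssocRing A] [Module k A] [IsScalarTower k A A]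
    [SMulCommClass k A A] :
    MemGeneratedVariety k (fun n => H n) A ↔ IsLeftSymmetric A := by
  constructor
  · intro h x y z
    let X := FreeNonUnitalNonAssocAlgebra.of k (X := ℕ)
    have hf := h {(X 0 * X 1) * X 2 - X 0 * (X 1 * X 2) - ((X 1 * X 0) * X 2 - X 1 * (X 0 * X 2))}
      (by
        rintro n _ rfl a
        have := LSWitt.isLeftSymmetric (a 0 : LSWitt k n) (a 1) (a 2)
        simp only [X, map_sub, map_mul, FreeNonUnitalNonAssocAlgebra.lift_of_apply]
        rw [sub_eq_zero]
        exact Subtype.ext this)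
      _ rfl (fun i => if i = 0 then x else if i = 1 then y else z)
    simpa [X, map_sub, map_mul, FreeNonUnitalNonAssocAlgebra.lift_of_apply, sub_eq_zero,
      -MonoidAlgebra.single_mul_single] using hf
  · intro hA S hS f hf a
    have hspan : f ∈ Submodule.span k (Set.range fun T : LabelledTree =>
        T.eval (FreeNonUnitalNonAssocAlgebra.of k (X := ℕ))) := by
      rw [LabelledTree.span_eval_of]; trivial
    obtain ⟨s, rfl⟩ := (Finsupp.mem_span_range_iff_exists_finsupp).1 hspan
    rw [LabelledTree.lift_sum_eval]
    refine LabelledTree.sum_smul_eval_eq_zero hA a s fun T => ?_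
    obtain ⟨n, d, v, hd, hcount⟩ := LSWitt.exists_constantCoeff_eval_eq_isoCount k T
    have h0 := hS n _ hf fun x => ⟨d x, hH n (hd x)⟩
    rw [LabelledTree.lift_sum_eval] at h0
    have h1 := congrArg (NonUnitalSubalgebraClass.subtype (H n)) h0
    simp only [map_sum, map_smul, map_zero, LabelledTree.map_eval] at h1
    have h2 := congrArg (fun D : LSWitt k n => constantCoeff (D.toDer (X v))) h1
    simp only [LSWitt.toDer_sum_apply, LSWitt.toDer_smul, LSWitt.toDer_zero, map_sum,
      Derivation.smul_apply, Derivation.zero_apply, map_zero, constantCoeff_smul] at h2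
    simpa [← hcount] using h2

theorem corollary8 (k : Type*) [Field k] [CharZero k]
    (A : Type*) [NonUnitalNonAssocRing A] [Module k A] [IsScalarTower k A A]
    [SMulCommClass k A A] :
    (MemGeneratedVariety k (fun n : ℕ+ => LSWitt.strongTriangular k n) A ↔ IsLeftSymmetric A) ∧
    (MemGeneratedVariety k (fun n : ℕ+ => LSWitt.triangular k n) A ↔ IsLeftSymmetric A) := by
  refine ⟨memGeneratedVariety_iff_isLeftSymmetric k _ (fun _ => le_rfl) A,
    memGeneratedVariety_iff_isLeftSymmetric k _ (fun n => ?_) A⟩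
  refine Submodule.span_mono (R := k) ?_
  rintro _ ⟨p, hp, rfl⟩
  exact ⟨p, fun j hj => hp j hj.le, rfl⟩

end
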